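/- **Theorem (Completeness of $\mathrm{DL}_{\mathrm{CBI}}$).** If a consecution $X \vdash Y$ is valid (with respect to all CBI-models), then it is provable in the display calculus $\mathrm{DL}_{\mathrm{CBI}}$. Here the notions are as follows. Fix a countably infinite set $\mathcal V$ of propositional variables. *Models.* A CBI-model is a tuple $\langle R,\circ,e,-,\infty\rangle$, where $e,\infty\in R$, $-:R\to R$, and $\circ:R\times R\to\mathcal P(R)$ is commutative and associative (with respect to the pointwise extension $U\circ V=\bigcup_{x\in U,y\in V}x\circ y$), $r\circ e=\{r\}$ for all $r$, and for each $x\in R$, $-x$ is the unique element $y\in R$ with $\infty\in x\circ y$. *Formulas.* $F ::= P\mid\top\mid\bot\mid\neg F\mid F\wedge F\mid F\vee F\mid F\to F\mid\top^*\mid\bot^*\mid{\sim}F\mid F*F\mid F\mathbin{\overset{*}{\vee}}F\mid F\mathbin{-\!*}F$, with $P\in\mathcal V$. For an environment $\rho:\mathcal V\to\mathcal P(R)$ and $r\in R$: $r\models_\rho P$ iff $r\in\rho(P)$; $\top,\bot,\neg,\wedge,\vee,\to$ are interpreted pointwise as in classical logic; and - $r\models_\rho\top^*$ iff $r=e$;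 $r\models_\rho\bot^*$ iff $r\neq\infty$; $r\models_\rho{\sim}F$ iff $-r\not\models_\rho F$; - $r\models_\rho F_1*F_2$ iff there are $r_1,r_2\in R$ with $r\in r_1\circ r_2$, $r_1\models_\rho F_1$ and $r_2\models_\rho F_2$; - $r\models_\rho F_1\mathbin{\overset{*}{\vee}}F_2$ iff for all $r_1,r_2\in R$, $-r\in r_1\circ r_2$ implies $-r_1\models_\rho F_1$ or $-r_2\models_\rho F_2$; - $r\models_\rho F_1\mathbin{-\!*}F_2$ iff for all $r',r''\in R$, $r''\in r\circ r'$ and $r'\models_\rho F_1$ imply $r''\models_\rho F_2$. A formula is valid if it is satisfied at every $r\in R$ under every $\rho$ in every CBI-model. *Consecutions.* Structures are given by $X::=F\mid\emptyset\mid\sharp X\mid X;X\mid\varnothing\mid\flat X\mid X,X$, where $F$ ranges over formulas, $\emptyset$ is the additive unit and $\varnothing$ the multiplicative one; a consecution $X\vdash Y$ is a pair of structures. Put $\Psi_F=\Upsilon_F=F$; $\Psi_\emptyset=\top$, $\Upsilon_\emptyset=\bot$; $\Psi_{\sharp X}=\neg\Upsilon_X$, $\Upsilon_{\sharp X}=\neg\Psi_X$;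 $\Psi_{X;Y}=\Psi_X\wedge\Psi_Y$, $\Upsilon_{X;Y}=\Upsilon_X\vee\Upsilon_Y$; $\Psi_\varnothing=\top^*$, $\Upsilon_\varnothing=\bot^*$; $\Psi_{\flat X}={\sim}\Upsilon_X$, $\Upsilon_{\flat X}={\sim}\Psi_X$; $\Psi_{X,Y}=\Psi_X*\Psi_Y$, $\Upsilon_{X,Y}=\Upsilon_X\mathbin{\overset{*}{\vee}}\Upsilon_Y$. The consecution $X\vdash Y$ is valid if the formula $\Psi_X\to\Upsilon_Y$ is valid. *The calculus.* Display-equivalence is the least equivalence relation on consecutions that identifies, for all structures $X,Y,Z$, the consecutions within each of the following groups: - $X;Y\vdash Z$, $\;X\vdash\sharp Y;Z$, $\;Y;X\vdash Z$; - $X\vdash Y;Z$, $\;X;\sharp Y\vdash Z$, $\;X\vdash Z;Y$; - $X\vdash Y$, $\;\sharp Y\vdash\sharp X$, $\;\sharp\sharp X\vdash Y$; and the same three groups with $;$ replaced by the comma and $\sharp$ by $\flat$. The set of provable consecutions is the least set closed under the following rules ($P\in\mathcal V$; $F,G$ formulas; $W,X,Y,Z$ structures; "$\Rightarrow$" leads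 from premises to conclusion, and "$\Leftrightarrow$" denotes rules in both directions). - Identity: $P\vdash P$; (cut) $X\vdash F$ and $F\vdash Y$ $\Rightarrow$ $X\vdash Y$; from a consecution infer any display-equivalent one. - Units: $\emptyset\vdash X\Rightarrow\top\vdash X$; $\emptyset\vdash\top$; $\bot\vdash\emptyset$; $X\vdash\emptyset\Rightarrow X\vdash\bot$; and the same four with $\varnothing,\top^*,\bot^*$ in place of $\emptyset,\top,\bot$. - Negations: $\sharp F\vdash X\Rightarrow\neg F\vdash X$; $X\vdash\sharp F\Rightarrow X\vdash\neg F$; and the same two with $\flat,\sim$ in place of $\sharp,\neg$. - Conjunctions: $F;G\vdash X\Rightarrow F\wedge G\vdash X$; $X\vdash F$ and $Y\vdash G$ $\Rightarrow$ $X;Y\vdash F\wedge G$; and the same two with the comma and $*$ in place of $;$ and $\wedge$. - Disjunctions: $F\vdash X$ and $G\vdash Y$ $\Rightarrow$ $F\vee G\vdash X;Y$; $X\vdash F;G\Rightarrow X\vdash F\vee G$; and the same two with the comma and $\overset{*}{\vee}$ in place of $;$ and $\vee$. - Implications: $X\vdash F$ and $G\vdash Y$ $\Rightarrow$ $F\to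 G\vdash\sharp X;Y$; $X;F\vdash G\Rightarrow X\vdash F\to G$; and the same two with the comma, $\flat$ and $-\!*$ in place of $;$, $\sharp$ and $\to$. - Structural rules: $W;(X;Y)\vdash Z\Leftrightarrow(W;X);Y\vdash Z$; $W\vdash(X;Y);Z\Leftrightarrow W\vdash X;(Y;Z)$; $\emptyset;X\vdash Y\Leftrightarrow X\vdash Y$; $X\vdash Y;\emptyset\Leftrightarrow X\vdash Y$; the same four with the comma and $\varnothing$ in place of $;$ and $\emptyset$; weakening $X\vdash Z\Rightarrow X;Y\vdash Z$ and $X\vdash Z\Rightarrow X\vdash Y;Z$; contraction $X;X\vdash Z\Rightarrow X\vdash Z$ and $X\vdash Z;Z\Rightarrow X\vdash Z$. -/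

import Mathlib

universe u

namespace CBI

/-- Formulas of `CBI`. The countably infinite set of propositional variables is `ℕ`. -/
inductive Formula : Type where
  | var (p : ℕ) : Formula
  | top : Formula
  | bot : Formula
  | neg (F : Formula) : Formula
  | and (F G : Formula) : Formula
  | or (F G : Formula) : Formula
  | imp (F G : Formula) : Formula
  /-- multiplicative truth `⊤*` -/
  | mtop : Formula
  /-- multiplicative falsity `⊥*` -/
  | mbot : Formula
  /-- multiplicative negation `∼F` -/
  | mneg (F : Formula) : Formula
  /-- multiplicative conjunction `F * G` -/
  | star (F G : Formula) : Formula
  /-- multiplicative disjunction, the De Morgan dual of `*` -/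
  | mor (F G : Formula) : Formula
  /-- multiplicative implication `F —* G` -/
  | wand (F G : Formula) : Formula

/-- The pointwise extension of `c : R → R → 𝒫(R)` to an operation `𝒫(R) → 𝒫(R) → 𝒫(R)`. -/
def compSet {R : Type u} (c : R → R → Set R) (X Y : Set R) : Set R :=
  ⋃ x ∈ X, ⋃ y ∈ Y, c x y

/-- A `BBI`-model on the set `R`: a relational commutative monoid. -/
structure BBIModel (R : Type u) where
  /-- the operation `∘` -/
  comp : R → R → Set R
  /-- the unit -/
  e : R
  comp_comm : ∀ x y, comp x y = comp y x
  comp_assoc : ∀ x y z, compSet comp (comp x y) {z} = compSet comp {x} (comp y z)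
  comp_unit : ∀ r, comp r e = {r}

/-- A `CBI`-model on the set `R`: a `BBI`-model with an operation `-` and an element `∞` such that
`-x` is the unique element satisfying `∞ ∈ x ∘ -x`. -/
structure Model (R : Type u) extends BBIModel R where
  /-- the operation `-` -/
  inv : R → R
  /-- the element `∞` -/
  infty : R
  infty_mem : ∀ x, infty ∈ comp x (inv x)
  inv_unique : ∀ x y, infty ∈ comp x y → y = inv x

/-- The satisfaction relation `r ⊨ F` with respect to an environment `ρ`. -/
def Sat {R : Type u} (M : Model R) (ρ : ℕ → Set R) : Formula → R → Prop
  | .var p, r => r ∈ ρ p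
  | .top, _ => True
  | .bot, _ => False
  | .neg F, r => ¬ Sat M ρ F r
  | .and F G, r => Sat M ρ F r ∧ Sat M ρ G r
  | .or F G, r => Sat M ρ F r ∨ Sat M ρ G r
  | .imp F G, r => Sat M ρ F r → Sat M ρ G r
  | .mtop, r => r = M.e
  | .mbot, r => r ≠ M.infty
  | .mneg F, r => ¬ Sat M ρ F (M.inv r)
  | .star F G, r => ∃ r₁ r₂, r ∈ M.comp r₁ r₂ ∧ Sat M ρ F r₁ ∧ Sat M ρ G r₂
  | .mor F G, r =>
      ∀ r₁ r₂, M.inv r ∈ M.comp r₁ r₂ → Sat M ρ F (M.inv r₁) ∨ Sat M ρ G (M.inv r₂)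
  | .wand F G, r => ∀ r' r'', r'' ∈ M.comp r r' ∧ Sat M ρ F r' → Sat M ρ G r''

/-- `F` is true in `M`: it is satisfied at every element in every environment. -/
def TrueIn {R : Type u} (M : Model R) (F : Formula) : Prop :=
  ∀ (ρ : ℕ → Set R) (r : R), Sat M ρ F r

/-- `F` is (`CBI`-)valid: it is true in all `CBI`-models. -/
def Formula.Valid (F : Formula) : Prop :=
  ∀ (R : Type u) (M : Model R), TrueIn M F

/-- Structures of the display calculus. -/
inductive Structure : Type where
  | form (F : Formula) : Structure
  /-- additive unit `∅` -/
  | aemp : Structure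
  /-- additive structural negation `♯X` -/
  | sharp (X : Structure) : Structure
  /-- additive combination `X ; Y` -/
  | semi (X Y : Structure) : Structure
  /-- multiplicative unit `∅` (slashed) -/
  | memp : Structure
  /-- multiplicative structural negation `♭X` -/
  | flat (X : Structure) : Structure
  /-- multiplicative combination `X , Y` -/
  | comma (X Y : Structure) : Structure

mutual

/-- The formula expressing the meaning of a structure as an antecedent. -/
def Structure.anteForm : Structure → Formula
  | .form F => F
  | .aemp => .top
  | .sharp X => .neg X.consForm
  | .semi X Y => .and X.anteForm Y.anteForm
  | .memp => .mtop
  | .flat X => .mneg X.consForm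
  | .comma X Y => .star X.anteForm Y.anteForm

/-- The formula expressing the meaning of a structure as a consequent. -/
def Structure.consForm : Structure → Formula
  | .form F => F
  | .aemp => .bot
  | .sharp X => .neg X.anteForm
  | .semi X Y => .or X.consForm Y.consForm
  | .memp => .mbot
  | .flat X => .mneg X.anteForm
  | .comma X Y => .mor X.consForm Y.consForm

end

/-- A consecution `X ⊢ Y`, written `⟨X, Y⟩`. -/
structure Consecution : Type where
  ante : Structure
  cons : Structure

/-- Validity of a consecution. -/
def Consecution.Valid (C : Consecution) : Prop :=
  Formula.Valid.{u} (.imp C.ante.anteForm C.cons.consForm)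

open Structure in
/-- The display postulates, each read from top to bottom. -/
inductive DisplayPostulate : Consecution → Consecution → Prop where
  | ad1a (X Y Z) : DisplayPostulate ⟨semi X Y, Z⟩ ⟨X, semi (sharp Y) Z⟩
  | ad1b (X Y Z) : DisplayPostulate ⟨X, semi (sharp Y) Z⟩ ⟨semi Y X, Z⟩
  | ad2a (X Y Z) : DisplayPostulate ⟨X, semi Y Z⟩ ⟨semi X (sharp Y), Z⟩
  | ad2b (X Y Z) : DisplayPostulate ⟨semi X (sharp Y), Z⟩ ⟨X, semi Z Y⟩
  | ad3a (X Y) : DisplayPostulate ⟨X, Y⟩ ⟨sharp Y, sharp X⟩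
  | ad3b (X Y) : DisplayPostulate ⟨sharp Y, sharp X⟩ ⟨sharp (sharp X), Y⟩
  | md1a (X Y Z) : DisplayPostulate ⟨comma X Y, Z⟩ ⟨X, comma (flat Y) Z⟩
  | md1b (X Y Z) : DisplayPostulate ⟨X, comma (flat Y) Z⟩ ⟨comma Y X, Z⟩
  | md2a (X Y Z) : DisplayPostulate ⟨X, comma Y Z⟩ ⟨comma X (flat Y), Z⟩
  | md2b (X Y Z) : DisplayPostulate ⟨comma X (flat Y), Z⟩ ⟨X, comma Z Y⟩
  | md3a (X Y) : DisplayPostulate ⟨X, Y⟩ ⟨flat Y, flat X⟩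
  | md3b (X Y) : DisplayPostulate ⟨flat Y, flat X⟩ ⟨flat (flat X), Y⟩

/-- Display-equivalence: one consecution is derivable from the other by display postulates, which
may be used in both directions. -/
def DisplayEquiv : Consecution → Consecution → Prop :=
  Relation.EqvGen DisplayPostulate

open Structure in
/-- Provability in the display calculus `DL_CBI`. Bidirectional rules are given as two rules. -/
inductive Provable : Consecution → Prop where
  -- identity rules
  | id (p : ℕ) : Provable ⟨form (.var p), form (.var p)⟩
  | cut {X Y : Structure} (F : Formula) :
      Provable ⟨X, form F⟩ → Provable ⟨form F, Y⟩ → Provable ⟨X, Y⟩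
  | display {C C' : Consecution} : DisplayEquiv C C' → Provable C' → Provable C
  -- logical rules
  | topL {X} : Provable ⟨aemp, X⟩ → Provable ⟨form .top, X⟩
  | topR : Provable ⟨aemp, form .top⟩
  | botL : Provable ⟨form .bot, aemp⟩
  | botR {X} : Provable ⟨X, aemp⟩ → Provable ⟨X, form .bot⟩
  | negL {F X} : Provable ⟨sharp (form F), X⟩ → Provable ⟨form (.neg F), X⟩
  | negR {F X} : Provable ⟨X, sharp (form F)⟩ → Provable ⟨X, form (.neg F)⟩
  | andL {F G X} : Provable ⟨semi (form F) (form G), X⟩ → Provable ⟨form (.and F G), X⟩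
  | andR {F G X Y} :
      Provable ⟨X, form F⟩ → Provable ⟨Y, form G⟩ → Provable ⟨semi X Y, form (.and F G)⟩
  | orL {F G X Y} :
      Provable ⟨form F, X⟩ → Provable ⟨form G, Y⟩ → Provable ⟨form (.or F G), semi X Y⟩
  | orR {F G X} : Provable ⟨X, semi (form F) (form G)⟩ → Provable ⟨X, form (.or F G)⟩
  | impL {F G X Y} :
      Provable ⟨X, form F⟩ → Provable ⟨form G, Y⟩ → Provable ⟨form (.imp F G), semi (sharp X) Y⟩
  | impR {F G X} : Provable ⟨semi X (form F), form G⟩ → Provable ⟨X, form (.imp F G)⟩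
  | mtopL {X} : Provable ⟨memp, X⟩ → Provable ⟨form .mtop, X⟩
  | mtopR : Provable ⟨memp, form .mtop⟩
  | mbotL : Provable ⟨form .mbot, memp⟩
  | mbotR {X} : Provable ⟨X, memp⟩ → Provable ⟨X, form .mbot⟩
  | mnegL {F X} : Provable ⟨flat (form F), X⟩ → Provable ⟨form (.mneg F), X⟩
  | mnegR {F X} : Provable ⟨X, flat (form F)⟩ → Provable ⟨X, form (.mneg F)⟩
  | starL {F G X} : Provable ⟨comma (form F) (form G), X⟩ → Provable ⟨form (.star F G), X⟩
  | starR {F G X Y} :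
      Provable ⟨X, form F⟩ → Provable ⟨Y, form G⟩ → Provable ⟨comma X Y, form (.star F G)⟩
  | morL {F G X Y} :
      Provable ⟨form F, X⟩ → Provable ⟨form G, Y⟩ → Provable ⟨form (.mor F G), comma X Y⟩
  | morR {F G X} : Provable ⟨X, comma (form F) (form G)⟩ → Provable ⟨X, form (.mor F G)⟩
  | wandL {F G X Y} :
      Provable ⟨X, form F⟩ → Provable ⟨form G, Y⟩ → Provable ⟨form (.wand F G), comma (flat X) Y⟩
  | wandR {F G X} : Provable ⟨comma X (form F), form G⟩ → Provable ⟨X, form (.wand F G)⟩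
  -- structural rules
  | aal {W X Y Z} : Provable ⟨semi W (semi X Y), Z⟩ → Provable ⟨semi (semi W X) Y, Z⟩
  | aal' {W X Y Z} : Provable ⟨semi (semi W X) Y, Z⟩ → Provable ⟨semi W (semi X Y), Z⟩
  | aar {W X Y Z} : Provable ⟨W, semi (semi X Y) Z⟩ → Provable ⟨W, semi X (semi Y Z)⟩
  | aar' {W X Y Z} : Provable ⟨W, semi X (semi Y Z)⟩ → Provable ⟨W, semi (semi X Y) Z⟩
  | mal {W X Y Z} : Provable ⟨comma W (comma X Y), Z⟩ → Provable ⟨comma (comma W X) Y, Z⟩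
  | mal' {W X Y Z} : Provable ⟨comma (comma W X) Y, Z⟩ → Provable ⟨comma W (comma X Y), Z⟩
  | mar {W X Y Z} : Provable ⟨W, comma (comma X Y) Z⟩ → Provable ⟨W, comma X (comma Y Z)⟩
  | mar' {W X Y Z} : Provable ⟨W, comma X (comma Y Z)⟩ → Provable ⟨W, comma (comma X Y) Z⟩
  | aempL {X Y} : Provable ⟨semi aemp X, Y⟩ → Provable ⟨X, Y⟩
  | aempL' {X Y} : Provable ⟨X, Y⟩ → Provable ⟨semi aemp X, Y⟩
  | aempR {X Y} : Provable ⟨X, semi Y aemp⟩ → Provable ⟨X, Y⟩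
  | aempR' {X Y} : Provable ⟨X, Y⟩ → Provable ⟨X, semi Y aemp⟩
  | mempL {X Y} : Provable ⟨comma memp X, Y⟩ → Provable ⟨X, Y⟩
  | mempL' {X Y} : Provable ⟨X, Y⟩ → Provable ⟨comma memp X, Y⟩
  | mempR {X Y} : Provable ⟨X, comma Y memp⟩ → Provable ⟨X, Y⟩
  | mempR' {X Y} : Provable ⟨X, Y⟩ → Provable ⟨X, comma Y memp⟩
  | wkL {X Y Z} : Provable ⟨X, Z⟩ → Provable ⟨semi X Y, Z⟩
  | wkR {X Y Z} : Provable ⟨X, Z⟩ → Provable ⟨X, semi Y Z⟩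
  | ctrL {X Z} : Provable ⟨semi X X, Z⟩ → Provable ⟨X, Z⟩
  | ctrR {X Z} : Provable ⟨X, semi Z Z⟩ → Provable ⟨X, Z⟩

end CBI

-- The proof builds a canonical model. Cut and the logical rules reduce provability of `X ⊢ Y` to
-- entailment between the formulas `X.anteForm` and `Y.consForm`. Worlds are prime filters of
-- formulas, with `C ∈ comp A B` when `F * G ∈ C` for all `F ∈ A` and `G ∈ B`. The separation lemma
-- `exists_world` supplies the worlds demanded by `*`, `—*` and associativity, through
-- `exists_extend_left`.
--
-- Duality is given by `F ∈ A.inv` iff `∼F ∉ A`; `A.inv` is the only world having a product with `A`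
-- that omits `⊥*`. More than one world may contain `⊤*`, whereas a model has a single unit. Each
-- world has exactly one unit `E`, though, and the worlds sharing it are closed under products,
-- factors and duals, so they form a CBI-model. Truth there is membership (`sat_iff_mem`), and an
-- unprovable entailment fails at a world separating its two sides.

namespace CBI

open Structure

/-! ### Derived rules of the display calculus -/

namespace Provable

theorem iff_of_postulate {C C' : Consecution} (h : DisplayPostulate C C') :
    Provable C ↔ Provable C' :=
  ⟨display (.symm _ _ (.rel _ _ h)), display (.rel _ _ h)⟩

variable {X Y Z : Structure}

theorem semi_left_comm : Provable ⟨semi X Y, Z⟩ ↔ Provable ⟨semi Y X, Z⟩ :=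
  (iff_of_postulate (.ad1a ..)).trans (iff_of_postulate (.ad1b ..))

theorem semi_right_comm : Provable ⟨X, semi Y Z⟩ ↔ Provable ⟨X, semi Z Y⟩ :=
  (iff_of_postulate (.ad2a ..)).trans (iff_of_postulate (.ad2b ..))

theorem comma_left_comm : Provable ⟨comma X Y, Z⟩ ↔ Provable ⟨comma Y X, Z⟩ :=
  (iff_of_postulate (.md1a ..)).trans (iff_of_postulate (.md1b ..))

theorem semi_left_iff : Provable ⟨semi X Y, Z⟩ ↔ Provable ⟨X, semi (sharp Y) Z⟩ :=
  iff_of_postulate (.ad1a ..)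

theorem semi_right_iff : Provable ⟨X, semi Y Z⟩ ↔ Provable ⟨semi X (sharp Y), Z⟩ :=
  iff_of_postulate (.ad2a ..)

theorem comma_left_iff : Provable ⟨comma X Y, Z⟩ ↔ Provable ⟨X, comma (flat Y) Z⟩ :=
  iff_of_postulate (.md1a ..)

theorem comma_right_iff : Provable ⟨X, comma Y Z⟩ ↔ Provable ⟨comma X (flat Y), Z⟩ :=
  iff_of_postulate (.md2a ..)

theorem sharp_iff : Provable ⟨sharp Y, sharp X⟩ ↔ Provable ⟨X, Y⟩ :=
  (iff_of_postulate (.ad3a ..)).symm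

theorem flat_iff : Provable ⟨flat Y, flat X⟩ ↔ Provable ⟨X, Y⟩ :=
  (iff_of_postulate (.md3a ..)).symm

theorem flat_flat_left : Provable ⟨flat (flat X), Y⟩ ↔ Provable ⟨X, Y⟩ :=
  (iff_of_postulate (.md3b ..)).symm.trans flat_iff

theorem flat_right_comm : Provable ⟨X, flat Y⟩ ↔ Provable ⟨Y, flat X⟩ :=
  flat_flat_left.symm.trans flat_iff

theorem flat_flat_right : Provable ⟨X, flat (flat Y)⟩ ↔ Provable ⟨X, Y⟩ :=
  flat_flat_left.symm.trans (flat_iff.trans flat_iff)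

theorem flat_left_comm : Provable ⟨flat X, Y⟩ ↔ Provable ⟨flat Y, X⟩ :=
  flat_iff.symm.trans flat_flat_right

theorem refl (F : Formula) : Provable ⟨form F, form F⟩ := by
  induction F with
  | var p => exact id p
  | top => exact topL topR
  | bot => exact botR botL
  | neg F ih => exact negL (negR (sharp_iff.2 ih))
  | and F G ihF ihG => exact andL (andR ihF ihG)
  | or F G ihF ihG => exact orR (orL ihF ihG)
  | imp F G ihF ihG => exact impR (semi_left_iff.2 (impL ihF ihG))
  | mtop => exact mtopL mtopR
  | mbot => exact mbotR mbotL
  | mneg F ih => exact mnegL (mnegR (flat_iff.2 ih))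
  | star F G ihF ihG => exact starL (starR ihF ihG)
  | mor F G ihF ihG => exact morR (morL ihF ihG)
  | wand F G ihF ihG => exact wandR (comma_left_iff.2 (wandL ihF ihG))

/-- The two halves are proved together because `♯` and `♭` swap them. With cut, they turn an
entailment of formulas back into a consecution. -/
theorem anteForm_and_consForm (X : Structure) :
    Provable ⟨X, form X.anteForm⟩ ∧ Provable ⟨form X.consForm, X⟩ := by
  induction X with
  | form F => exact ⟨refl F, refl F⟩
  | aemp => exact ⟨topR, botL⟩
  | sharp X ih => exact ⟨negR (sharp_iff.2 ih.2), negL (sharp_iff.2 ih.1)⟩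
  | semi X Y ihX ihY => exact ⟨andR ihX.1 ihY.1, orL ihX.2 ihY.2⟩
  | memp => exact ⟨mtopR, mbotL⟩
  | flat X ih => exact ⟨mnegR (flat_iff.2 ih.2), mnegL (flat_iff.2 ih.1)⟩
  | comma X Y ihX ihY => exact ⟨starR ihX.1 ihY.1, morL ihX.2 ihY.2⟩

end Provable

/-! ### Entailment between formulas -/

/-- Provable entailment between formulas. -/
def Entails (F G : Formula) : Prop := Provable ⟨form F, form G⟩

namespace Entails

open Formula Provable

variable {F F' G G' H K : Formula}

theorem refl (F : Formula) : Entails F F := Provable.refl F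

theorem trans (h₁ : Entails F G) (h₂ : Entails G H) : Entails F H := cut G h₁ h₂

theorem provable {X Y : Structure} (h : Entails X.anteForm Y.consForm) : Provable ⟨X, Y⟩ :=
  cut _ (anteForm_and_consForm X).1 (cut _ h (anteForm_and_consForm Y).2)

theorem top_right (F : Formula) : Entails F .top := aempL (wkL topR)

theorem bot_left (F : Formula) : Entails .bot F := aempR (wkR botL)

theorem and_left (F G : Formula) : Entails (.and F G) F := andL (wkL (refl F))

theorem and_right (F G : Formula) : Entails (.and F G) G :=
  andL (semi_left_comm.1 (wkL (refl G)))

theorem and_intro (h₁ : Entails F G) (h₂ : Entails F H) : Entails F (.and G H) :=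
  ctrL (andR h₁ h₂)

theorem or_left (F G : Formula) : Entails F (.or F G) := orR (semi_right_comm.1 (wkR (Provable.refl F)))

theorem or_right (F G : Formula) : Entails G (.or F G) := orR (wkR (refl G))

theorem or_elim (h₁ : Entails F H) (h₂ : Entails G H) : Entails (.or F G) H :=
  ctrR (orL h₁ h₂)

theorem imp_intro (h : Entails (.and F G) H) : Entails F (.imp G H) :=
  impR (cut _ (andR (refl F) (refl G)) h)

theorem imp_mp (F G : Formula) : Entails (.and (.imp F G) F) G :=
  andL (semi_left_iff.2 (impL (refl F) (refl G)))

theorem and_neg (F : Formula) : Entails (.and (.neg F) F) .bot :=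
  andL (semi_left_iff.2 (semi_right_comm.1
    (wkR (negL (sharp_iff.2 (refl F))))))

theorem or_neg (F : Formula) : Entails .top (.or F (.neg F)) :=
  orR (semi_right_iff.2 (semi_left_comm.1 (wkL (negR (sharp_iff.2 (refl F))))))

theorem imp_of_neg (F G : Formula) : Entails (.neg F) (.imp F G) :=
  impR (semi_left_iff.2 (semi_right_comm.1
    (wkR (negL (sharp_iff.2 (refl F))))))

theorem star_mono (h₁ : Entails F F') (h₂ : Entails G G') :
    Entails (.star F G) (.star F' G') := starL (starR h₁ h₂)

theorem star_comm (F G : Formula) : Entails (.star F G) (.star G F) :=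
  starL (comma_left_comm.1 (starR (refl G) (refl F)))

theorem star_assoc (F G H : Formula) :
    Entails (.star (.star F G) H) (.star F (.star G H)) :=
  starL (comma_left_iff.2 (starL (comma_left_iff.1
    (mal (starR (refl F) (starR (refl G) (refl H)))))))

theorem star_assoc_symm (F G H : Formula) :
    Entails (.star F (.star G H)) (.star (.star F G) H) :=
  starL (comma_left_comm.1 (comma_left_iff.2 (starL (comma_left_iff.1 (comma_left_comm.1
    (mal' (starR (starR (refl F) (refl G)) (refl H))))))))

theorem star_mtop (F : Formula) : Entails (.star F .mtop) F :=
  starL (comma_left_comm.1 (comma_left_iff.2 (mtopL (comma_left_iff.1 (mempL' (refl F))))))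

theorem star_mtop_symm (F : Formula) : Entails F (.star F .mtop) :=
  mempL (comma_left_comm.1 (starR (refl F) mtopR))

theorem wand_intro (h : Entails (.star F G) H) : Entails F (.wand G H) :=
  wandR (cut _ (starR (refl F) (refl G)) h)

theorem wand_mp (F G : Formula) : Entails (.star (.wand F G) F) G :=
  starL (comma_left_iff.2 (wandL (refl F) (refl G)))

/-- Residuation: `F` and `G` each entail `H —* (F * H ∨ G * H)`, hence so does their disjunction. -/
theorem star_or (F G H : Formula) :
    Entails (.star (.or F G) H) (.or (.star F H) (.star G H)) :=
  (star_mono (or_elim (wand_intro (or_left _ _)) (wand_intro (or_right _ _))) (refl H)).trans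
    (wand_mp _ _)

theorem mneg_anti (h : Entails F G) : Entails (.mneg G) (.mneg F) :=
  mnegL (mnegR (flat_iff.2 h))

theorem mneg_mneg (F : Formula) : Entails (.mneg (.mneg F)) F :=
  mnegL (flat_left_comm.1 (mnegR (flat_iff.2 (refl F))))

theorem mneg_mneg_symm (F : Formula) : Entails F (.mneg (.mneg F)) :=
  mnegR (flat_right_comm.1 (mnegL (flat_iff.2 (refl F))))

theorem mneg_star (F : Formula) : Entails (.star (.mneg F) F) .mbot :=
  starL (mbotR (comma_left_iff.2 (mempR' (mnegL (flat_iff.2 (refl F))))))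

/-- Together with `mneg_star`, this makes `∼G` the residual of `⊥*` by `G`. -/
theorem mneg_intro (h : Entails (.star F G) .mbot) : Entails F (.mneg G) :=
  mnegR (mempR (comma_left_iff.1 (cut _ (cut _ (starR (refl F) (refl G)) h) mbotL)))

theorem mor_star_mneg (F G : Formula) : Entails (.star (.mor F G) (.mneg F)) G :=
  starL (comma_left_comm.1 (comma_left_iff.2 (mnegL (comma_left_iff.1
    (comma_left_comm.1 (comma_right_iff.1 (morL (refl F) (refl G))))))))

theorem mor_left (F G : Formula) :
    Entails (.mor F G) (.mneg (.star (.mneg F) (.mneg G))) :=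
  mneg_intro ((star_assoc_symm _ _ _).trans
    ((star_mono (mor_star_mneg F G) (refl _)).trans ((star_comm _ _).trans (mneg_star G))))

theorem mor_right (F G : Formula) :
    Entails (.mneg (.star (.mneg F) (.mneg G))) (.mor F G) := by
  -- Moving `F` to the left as `♭F` leaves `∼(∼F * ∼G) * ∼F ⊢ G`, which follows from `∼∼G ⊢ G`.
  refine morR (comma_right_iff.2 (cut _ (starR (refl _) (mnegR (flat_iff.2 (refl F)))) ?_))
  exact trans (mneg_intro ((star_assoc _ _ _).trans (mneg_star _))) (mneg_mneg G)

/-- The De Morgan laws hold because `∼` is an antitone involution up to entailment. -/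
theorem mneg_or (F G : Formula) :
    Entails (.and (.mneg F) (.mneg G)) (.mneg (.or F G)) :=
  (mneg_mneg_symm _).trans (mneg_anti (or_elim
    ((mneg_mneg_symm F).trans (mneg_anti (and_left _ _)))
    ((mneg_mneg_symm G).trans (mneg_anti (and_right _ _)))))

theorem mneg_and (F G : Formula) :
    Entails (.mneg (.and F G)) (.or (.mneg F) (.mneg G)) :=
  (mneg_anti (and_intro ((mneg_anti (or_left _ _)).trans (mneg_mneg F))
    ((mneg_anti (or_right _ _)).trans (mneg_mneg G)))).trans (mneg_mneg _)

theorem mneg_bot (F : Formula) : Entails F (.mneg .bot) :=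
  (mneg_mneg_symm F).trans (mneg_anti (bot_left _))

end Entails

/-! ### Filters and prime filters of formulas -/

/-- A deductively closed set of formulas. -/
structure IsFilter (T : Set Formula) : Prop where
  top : .top ∈ T
  and {F G : Formula} : F ∈ T → G ∈ T → .and F G ∈ T
  mono {F G : Formula} : F ∈ T → Entails F G → G ∈ T

/-- The order dual of a deductively closed set of formulas. -/
structure IsIdeal (I : Set Formula) : Prop where
  bot : .bot ∈ I
  or {F G : Formula} : F ∈ I → G ∈ I → .or F G ∈ I
  mono {F G : Formula} : G ∈ I → Entails F G → F ∈ I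

theorem isFilter_principal (F : Formula) : IsFilter {G | Entails F G} where
  top := .top_right F
  and h₁ h₂ := .and_intro h₁ h₂
  mono h₁ h₂ := .trans h₁ h₂

theorem isIdeal_principal (F : Formula) : IsIdeal {G | Entails G F} where
  bot := .bot_left F
  or h₁ h₂ := .or_elim h₁ h₂
  mono h₁ h₂ := .trans h₂ h₁

/-- The filter generated by the products of elements of two filters. -/
def starSet (S T : Set Formula) : Set Formula :=
  {H | ∃ F ∈ S, ∃ G ∈ T, Entails (.star F G) H}

theorem IsFilter.starSet {S T : Set Formula} (hS : IsFilter S) (hT : IsFilter T) :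
    IsFilter (starSet S T) where
  top := ⟨_, hS.top, _, hT.top, .top_right _⟩
  and := by
    rintro H K ⟨F, hF, G, hG, h⟩ ⟨F', hF', G', hG', h'⟩
    exact ⟨_, hS.and hF hF', _, hT.and hG hG', .and_intro
      ((Entails.star_mono (.and_left _ _) (.and_left _ _)).trans h)
      ((Entails.star_mono (.and_right _ _) (.and_right _ _)).trans h')⟩
  mono := by
    rintro H K ⟨F, hF, G, hG, h⟩ h'
    exact ⟨F, hF, G, hG, h.trans h'⟩

/-- Prime filters of formulas, the worlds of the canonical frame. -/
@[ext]
structure World : Type u where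
  carrier : Set Formula
  isFilter : IsFilter carrier
  bot_notMem : .bot ∉ carrier
  prime {F G : Formula} : .or F G ∈ carrier → F ∈ carrier ∨ G ∈ carrier

/-- The prime filter theorem: a filter maximal among those disjoint from `I` is prime, by
distributivity in the form of `→`. -/
theorem exists_world {T I : Set Formula} (hT : IsFilter T) (hI : IsIdeal I)
    (hTI : Disjoint T I) : ∃ A : World.{u}, T ⊆ A.carrier ∧ Disjoint A.carrier I := by
  obtain ⟨S, hTS, hS⟩ := zorn_subset_nonempty {S | IsFilter S ∧ Disjoint S I} (by
    intro c hc hchain hne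
    refine ⟨⋃₀ c, ⟨⟨?_, ?_, ?_⟩, ?_⟩, fun s hs => Set.subset_sUnion_of_mem hs⟩
    · obtain ⟨s, hs⟩ := hne
      exact ⟨s, hs, (hc hs).1.top⟩
    · rintro F G ⟨s, hs, hF⟩ ⟨t, ht, hG⟩
      rcases hchain.total hs ht with h | h
      · exact ⟨t, ht, (hc ht).1.and (h hF) hG⟩
      · exact ⟨s, hs, (hc hs).1.and hF (h hG)⟩
    · rintro F G ⟨s, hs, hF⟩ h
      exact ⟨s, hs, (hc hs).1.mono hF h⟩
    · exact Set.disjoint_sUnion_left.2 fun s hs => (hc hs).2) T ⟨hT, hTI⟩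
  obtain ⟨hSf, hSI⟩ := hS.prop
  have hmeet : ∀ F, F ∉ S → ∃ G ∈ S, ∃ H ∈ I, Entails F (.imp G H) := by
    intro F hF
    by_contra! hcon
    -- This is the filter generated by `S` and `F`; if it missed `I`, maximality would force `F ∈
    -- S`.
    have hfil : IsFilter {H | ∃ G ∈ S, Entails F (.imp G H)} := by
      refine ⟨⟨_, hSf.top, .imp_intro (.top_right _)⟩, ?_, ?_⟩
      · rintro H K ⟨G, hG, h⟩ ⟨G', hG', h'⟩
        refine ⟨_, hSf.and hG hG', .imp_intro (.and_intro ?_ ?_)⟩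
        · exact (Entails.and_intro ((Entails.and_left _ _).trans h)
            ((Entails.and_right _ _).trans (.and_left _ _))).trans (.imp_mp _ _)
        · exact (Entails.and_intro ((Entails.and_left _ _).trans h')
            ((Entails.and_right _ _).trans (.and_right _ _))).trans (.imp_mp _ _)
      · rintro H K ⟨G, hG, h⟩ h'
        refine ⟨G, hG, .imp_intro (Entails.trans ?_ ((Entails.imp_mp G H).trans h'))⟩
        exact .and_intro ((Entails.and_left _ _).trans h) (.and_right _ _)
    refine hF (hS.le_of_ge ⟨hfil, Set.disjoint_left.2 ?_⟩ ?_
      ⟨_, hSf.top, .imp_intro (.and_left _ _)⟩)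
    · rintro H ⟨G, hG, h⟩ hH
      exact hcon G hG H hH h
    · exact fun G hG => ⟨G, hG, .imp_intro (.and_right _ _)⟩
  refine ⟨⟨S, hSf, fun h => Set.disjoint_left.1 hSI h hI.bot, fun {F G} h => ?_⟩, hTS, hSI⟩
  by_contra! hcon
  obtain ⟨K, hK, H, hH, h₁⟩ := hmeet F hcon.1
  obtain ⟨K', hK', H', hH', h₂⟩ := hmeet G hcon.2
  have h₃ : Entails (.or F G) (.imp (.and K K') (.or H H')) := by
    refine .or_elim (.imp_intro ?_) (.imp_intro ?_)
    · exact ((Entails.and_intro ((Entails.and_left _ _).trans h₁)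
        ((Entails.and_right _ _).trans (.and_left _ _))).trans (.imp_mp _ _)).trans
          (.or_left _ _)
    · exact ((Entails.and_intro ((Entails.and_left _ _).trans h₂)
        ((Entails.and_right _ _).trans (.and_right _ _))).trans (.imp_mp _ _)).trans
          (.or_right _ _)
  exact Set.disjoint_left.1 hSI
    (hSf.mono (hSf.and (hSf.mono h h₃) (hSf.and hK hK')) (.imp_mp _ _)) (hI.or hH hH')

theorem exists_world_of_notMem {T : Set Formula} (hT : IsFilter T) {F : Formula} (hF : F ∉ T) :
    ∃ A : World.{u}, T ⊆ A.carrier ∧ F ∉ A.carrier := by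
  obtain ⟨A, hA, hd⟩ := exists_world.{u} hT (isIdeal_principal F)
    (Set.disjoint_left.2 fun G hG h => hF (hT.mono hG h))
  exact ⟨A, hA, fun h => Set.disjoint_left.1 hd h (Entails.refl F)⟩

-- Worlds as maximal consistent sets.

namespace World

variable {A B C D : World.{u}} {F G : Formula}

instance : Membership Formula World.{u} := ⟨fun A F => F ∈ A.carrier⟩

theorem mono (h : F ∈ A) (hFG : Entails F G) : G ∈ A := A.isFilter.mono h hFG

theorem top_mem (A : World.{u}) : .top ∈ A := A.isFilter.top

theorem and_mem : .and F G ∈ A ↔ F ∈ A ∧ G ∈ A :=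
  ⟨fun h => ⟨mono h (.and_left _ _), mono h (.and_right _ _)⟩, fun h => A.isFilter.and h.1 h.2⟩

theorem or_mem : .or F G ∈ A ↔ F ∈ A ∨ G ∈ A :=
  ⟨A.prime, fun h => h.elim (mono · (.or_left _ _)) (mono · (.or_right _ _))⟩

theorem neg_mem : .neg F ∈ A ↔ F ∉ A :=
  ⟨fun h h' => A.bot_notMem (mono (and_mem.2 ⟨h, h'⟩) (.and_neg F)),
    fun h => (or_mem.1 (mono A.top_mem (.or_neg F))).resolve_left h⟩

theorem imp_mem : .imp F G ∈ A ↔ (F ∈ A → G ∈ A) := by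
  refine ⟨fun h h' => mono (and_mem.2 ⟨h, h'⟩) (.imp_mp F G), fun h => ?_⟩
  by_cases hF : F ∈ A
  · exact mono (h hF) (.imp_intro (.and_left _ _))
  · exact mono (neg_mem.2 hF) (.imp_of_neg _ _)

/-- Classical negation makes every world a maximal proper filter. -/
theorem eq_of_subset (h : ∀ F, F ∈ A → F ∈ B) : A = B := by
  ext F
  refine ⟨h F, fun hF => ?_⟩
  by_contra hA
  exact neg_mem.1 (h _ (neg_mem.2 hA)) hF

/-! ### The canonical frame -/

/-- Composition of worlds. -/
def comp (A B : World.{u}) : Set World.{u} :=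
  {C | ∀ F ∈ A, ∀ G ∈ B, .star F G ∈ C}

theorem comp_comm (A B : World.{u}) : comp A B = comp B A := by
  ext C
  exact ⟨fun h F hF G hG => mono (h G hG F hF) (.star_comm _ _),
    fun h F hF G hG => mono (h G hG F hF) (.star_comm _ _)⟩

/-- The formulas `F` with `F * G ∉ C` for some `G ∈ T` form an ideal, since `*` distributes over `∨`
and `C` is prime. Separating `S` from it enlarges one factor to a world; the other factor is then
treated by commutativity. -/
theorem exists_extend_left {S T : Set Formula} (hS : IsFilter S) (hT : IsFilter T)
    (h : ∀ F ∈ S, ∀ G ∈ T, .star F G ∈ C) :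
    ∃ A : World.{u}, S ⊆ A.carrier ∧ ∀ F ∈ A, ∀ G ∈ T, .star F G ∈ C := by
  have hI : IsIdeal {F | ∃ G ∈ T, .star F G ∉ C} := by
    refine ⟨⟨_, hT.top, fun hc => C.bot_notMem (mono hc ?_)⟩, ?_, ?_⟩
    -- `⊥ * ⊤` entails `⊥` because `⊥` entails `⊤ —* ⊥`.
    · exact (Entails.star_mono (.bot_left _) (.refl _)).trans (.wand_mp .top .bot)
    · rintro F F' ⟨G, hG, hF⟩ ⟨G', hG', hF'⟩
      refine ⟨_, hT.and hG hG', fun hc => ?_⟩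
      rcases or_mem.1 (mono hc (.star_or _ _ _)) with h | h
      · exact hF (mono h (.star_mono (.refl _) (.and_left _ _)))
      · exact hF' (mono h (.star_mono (.refl _) (.and_right _ _)))
    · rintro F F' ⟨G, hG, hF⟩ h'
      exact ⟨G, hG, fun hc => hF (mono hc (.star_mono h' (.refl _)))⟩
  obtain ⟨A, hA, hd⟩ := exists_world.{u} hS hI
    (Set.disjoint_left.2 fun F hF ⟨G, hG, hFG⟩ => hFG (h F hF G hG))
  refine ⟨A, hA, fun F hF G hG => ?_⟩
  by_contra hc
  exact Set.disjoint_left.1 hd hF ⟨G, hG, hc⟩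

theorem exists_extend_right {T : Set Formula} (hT : IsFilter T)
    (h : ∀ F ∈ A, ∀ G ∈ T, .star F G ∈ C) :
    ∃ B : World.{u}, T ⊆ B.carrier ∧ C ∈ comp A B := by
  obtain ⟨B, hB, h'⟩ := exists_extend_left (C := C) hT A.isFilter
    fun F hF G hG => mono (h G hG F hF) (.star_comm _ _)
  exact ⟨B, hB, comp_comm A B ▸ h'⟩

theorem exists_comp {S T : Set Formula} (hS : IsFilter S) (hT : IsFilter T)
    (h : ∀ F ∈ S, ∀ G ∈ T, .star F G ∈ C) :
    ∃ A B : World.{u}, S ⊆ A.carrier ∧ T ⊆ B.carrier ∧ C ∈ comp A B := by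
  obtain ⟨A, hA, h'⟩ := exists_extend_left hS hT h
  obtain ⟨B, hB, h''⟩ := exists_extend_right hT h'
  exact ⟨A, B, hA, hB, h''⟩

theorem star_mem : .star F G ∈ C ↔ ∃ A B : World.{u}, C ∈ comp A B ∧ F ∈ A ∧ G ∈ B := by
  refine ⟨fun h => ?_, fun ⟨A, B, hC, hF, hG⟩ => hC F hF G hG⟩
  obtain ⟨A, B, hA, hB, hC⟩ := exists_comp (C := C) (isFilter_principal F) (isFilter_principal G)
    fun F' hF' G' hG' => mono h (.star_mono hF' hG')
  exact ⟨A, B, hC, hA (Entails.refl F), hB (Entails.refl G)⟩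

theorem wand_mem :
    .wand F G ∈ A ↔ ∀ B C : World.{u}, C ∈ comp A B ∧ F ∈ B → G ∈ C := by
  refine ⟨fun h B C hC => mono (hC.1 _ h _ hC.2) (.wand_mp F G), fun h => ?_⟩
  by_contra hA
  obtain ⟨C, hC, hG⟩ := exists_world_of_notMem.{u}
    (F := G) (A.isFilter.starSet (isFilter_principal F)) (by
      rintro ⟨H, hH, K, hK, hHK⟩
      exact hA (mono hH (.wand_intro ((Entails.star_mono (.refl _) hK).trans hHK))))
  obtain ⟨B, hB, hB'⟩ := exists_extend_right (A := A) (C := C) (isFilter_principal F)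
    fun H hH K hK => hC ⟨H, hH, K, hK, .refl _⟩
  exact hG (h B C ⟨hB', hB (Entails.refl F)⟩)

/-- The product filter of `B` and `C` is compatible with `A` and `D` by associativity of `*`, so it
extends to the required world. -/
theorem exists_assoc {W : World.{u}} (hW : W ∈ comp A B) (hD : D ∈ comp W C) :
    ∃ V ∈ comp B C, D ∈ comp A V := by
  obtain ⟨V, hV, hV'⟩ := exists_extend_right (A := A) (C := D)
    (B.isFilter.starSet C.isFilter) (by
      rintro F hF K ⟨G, hG, H, hH, h⟩
      exact mono (hD _ (hW F hF G hG) H hH)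
        ((Entails.star_assoc _ _ _).trans (.star_mono (.refl _) h)))
  exact ⟨V, fun G hG H hH => hV ⟨G, hG, H, hH, .refl _⟩, hV'⟩

theorem exists_assoc_symm {V : World.{u}} (hV : V ∈ comp B C) (hD : D ∈ comp A V) :
    ∃ W ∈ comp A B, D ∈ comp W C := by
  rw [comp_comm] at hV hD
  obtain ⟨W, hW, hD⟩ := exists_assoc hV hD
  rw [comp_comm] at hW hD
  exact ⟨W, hW, hD⟩

/-- The dual of a world. -/
def inv (A : World.{u}) : World.{u} where
  -- Forced by the satisfaction clause for `∼`.
  carrier := {F | .mneg F ∉ A}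
  isFilter :=
    { top := fun h => A.bot_notMem (mono h ((Entails.mneg_anti (.top_right _)).trans
        (.mneg_mneg _)))
      and := fun hF hG h => (or_mem.1 (mono h (.mneg_and _ _))).elim hF hG
      mono := fun hF hFG h => hF (mono h (.mneg_anti hFG)) }
  bot_notMem h := h (mono A.top_mem (.mneg_bot _))
  prime {F G} h := by
    by_contra! hcon
    simp only [Set.mem_ofPred_eq, not_not] at hcon
    exact h (mono (and_mem.2 hcon) (.mneg_or _ _))

theorem mem_inv : F ∈ A.inv ↔ .mneg F ∉ A := Iff.rfl

theorem mneg_mem : .mneg F ∈ A ↔ F ∉ A.inv := by simp [mem_inv]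

theorem mor_mem : .mor F G ∈ A ↔
    ∀ B C : World.{u}, A.inv ∈ comp B C → F ∈ B.inv ∨ G ∈ C.inv := by
  have h : .mor F G ∈ A ↔ .mneg (.star (.mneg F) (.mneg G)) ∈ A :=
    ⟨fun h => mono h (.mor_left F G), fun h => mono h (.mor_right F G)⟩
  rw [h, mneg_mem, star_mem]
  simp only [mem_inv]
  grind

/-- If `F * G` entailed `⊥*` with `F ∈ A` and `G ∈ A.inv`, then `∼G ∈ A`, a contradiction. So the
product filter omits `⊥*`. -/
theorem exists_mem_comp_inv (A : World.{u}) : ∃ C ∈ comp A A.inv, .mbot ∉ C := by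
  obtain ⟨C, hC, h⟩ := exists_world_of_notMem.{u}
    (F := .mbot) (A.isFilter.starSet A.inv.isFilter) (by
      rintro ⟨F, hF, G, hG, h⟩
      exact hG (mono hF (.mneg_intro h)))
  exact ⟨C, fun F hF G hG => hC ⟨F, hF, G, hG, .refl _⟩, h⟩

/-- Some `F ∈ B` outside `A.inv` would give `∼F ∈ A`, hence `∼F * F ∈ C` and `⊥* ∈ C`. -/
theorem eq_inv (hC : C ∈ comp A B) (h : .mbot ∉ C) : B = A.inv :=
  eq_of_subset fun _ hF h' => h (mono (hC _ h' _ hF) (.mneg_star _))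

/-! ### The connected component of a unit -/

variable {E E' : World.{u}}

theorem exists_unit (A : World.{u}) : ∃ E : World.{u}, .mtop ∈ E ∧ A ∈ comp A E := by
  obtain ⟨E, hE, h⟩ := exists_extend_right (A := A) (C := A) (isFilter_principal .mtop)
    fun F hF G hG => mono hF ((Entails.star_mtop_symm F).trans (.star_mono (.refl _) hG))
  exact ⟨E, hE (Entails.refl _), h⟩

theorem eq_of_mem_comp_unit (hE : .mtop ∈ E) (h : B ∈ comp A E) : B = A :=
  (eq_of_subset fun F hF => mono (h F hF _ hE) (.star_mtop F)).symm

theorem unit_unique (hE : .mtop ∈ E) (hE' : .mtop ∈ E') (h : A ∈ comp A E)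
    (h' : A ∈ comp A E') : E = E' := by
  obtain ⟨V, hV, -⟩ := exists_assoc h h'
  have hVE := eq_of_mem_comp_unit hE' hV
  rw [comp_comm] at hV
  exact hVE.symm.trans (eq_of_mem_comp_unit hE hV)

/-- Reassociating with `E` inserted yields a world in `E ∘ B`, which must be `B`; the argument for
`C` is similar. Hence a unit of one factor is a unit of the other factor and of every product. -/
theorem mem_comp_unit_of_mem_comp (hE : .mtop ∈ E) (hA : A ∈ comp A E) (hC : C ∈ comp A B) :
    B ∈ comp B E ∧ C ∈ comp C E := by
  constructor
  · obtain ⟨V, hV, -⟩ := exists_assoc hA hC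
    rw [comp_comm] at hV
    exact (eq_of_mem_comp_unit hE hV) ▸ hV
  · rw [comp_comm] at hA
    obtain ⟨V, -, hV⟩ := exists_assoc hA hC
    rw [comp_comm] at hV
    exact (eq_of_mem_comp_unit hE hV) ▸ hV

theorem mem_comp_unit_of_comp_mem (hE : .mtop ∈ E) (hC : C ∈ comp C E) (h : C ∈ comp A B) :
    A ∈ comp A E ∧ B ∈ comp B E := by
  have hB : B ∈ comp B E := by
    obtain ⟨V, hV, -⟩ := exists_assoc h hC
    exact (eq_of_mem_comp_unit hE hV) ▸ hV
  refine ⟨?_, hB⟩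
  rw [comp_comm] at h
  exact (mem_comp_unit_of_mem_comp hE hB h).1

theorem unit_mem_comp_self (hE : .mtop ∈ E) : E ∈ comp E E := by
  obtain ⟨E', hE', h⟩ := exists_unit E
  have h' := h
  rw [comp_comm] at h'
  obtain rfl := eq_of_mem_comp_unit hE h'
  exact h

theorem inv_mem_comp_unit (hE : .mtop ∈ E) (hA : A ∈ comp A E) : A.inv ∈ comp A.inv E := by
  obtain ⟨C, hC, -⟩ := exists_mem_comp_inv A
  exact (mem_comp_unit_of_mem_comp hE hA hC).1

/-- Within a component only one world omits `⊥*`, so `E.inv` can serve as `∞`. -/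
theorem eq_inv_unit (hA : A ∈ comp A E) (h : .mbot ∉ A) : A = E.inv := by
  rw [comp_comm] at hA
  exact eq_inv hA h

theorem mbot_notMem_inv_unit (hE : .mtop ∈ E) : .mbot ∉ E.inv := by
  obtain ⟨C, hC, h⟩ := exists_mem_comp_inv E
  rwa [← eq_inv_unit (mem_comp_unit_of_mem_comp hE (unit_mem_comp_self hE) hC).2 h]

/-- The worlds on which `E` acts as a unit. -/
def Component (E : World.{u}) : Type u := {A : World.{u} // A ∈ comp A E}

/-- The canonical model on the component of a unit `E`. -/
def model (E : World.{u}) (hE : .mtop ∈ E) : Model (Component E) where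
  comp A B := {C | C.1 ∈ comp A.1 B.1}
  e := ⟨E, unit_mem_comp_self hE⟩
  comp_comm A B := by rw [World.comp_comm]
  comp_assoc A B C := by
    ext D
    simp only [compSet, Set.mem_iUnion, Set.mem_singleton_iff, Set.mem_ofPred_eq, exists_prop,
      exists_eq_left]
    constructor
    · rintro ⟨W, hW, hD⟩
      obtain ⟨V, hV, hD'⟩ := exists_assoc hW hD
      exact ⟨⟨V, (mem_comp_unit_of_mem_comp hE B.2 hV).2⟩, hV, hD'⟩
    · rintro ⟨V, hV, hD⟩
      obtain ⟨W, hW, hD'⟩ := exists_assoc_symm hV hD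
      exact ⟨⟨W, (mem_comp_unit_of_mem_comp hE A.2 hW).2⟩, hW, hD'⟩
  comp_unit A := by
    ext B
    refine ⟨fun h => Subtype.ext (eq_of_mem_comp_unit hE h), ?_⟩
    rintro rfl
    exact B.2
  inv A := ⟨A.1.inv, inv_mem_comp_unit hE A.2⟩
  infty := ⟨E.inv, inv_mem_comp_unit hE (unit_mem_comp_self hE)⟩
  infty_mem A := by
    obtain ⟨C, hC, h⟩ := exists_mem_comp_inv A.1
    obtain rfl := eq_inv_unit (mem_comp_unit_of_mem_comp hE A.2 hC).2 h
    exact hC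
  inv_unique A B h := Subtype.ext (eq_inv h (mbot_notMem_inv_unit hE))

/-- The truth lemma. The clauses for `*`, its dual and `—*` quantify over the component only, which
loses nothing because factors and products of its worlds stay in it. -/
theorem sat_iff_mem (hE : .mtop ∈ E) (F : Formula) (A : Component E) :
    Sat (model E hE) (fun p => {A | .var p ∈ A.1}) F A ↔ F ∈ A.1 := by
  induction F generalizing A with
  | var p => rfl
  | top => simp [Sat, top_mem]
  | bot => exact ⟨False.elim, fun h => A.1.bot_notMem h⟩
  | neg F ih => simp only [Sat, ih, neg_mem]
  | and F G ihF ihG => simp only [Sat, ihF, ihG, and_mem]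
  | or F G ihF ihG => simp only [Sat, ihF, ihG, or_mem]
  | imp F G ihF ihG => simp only [Sat, ihF, ihG, imp_mem]
  | mtop =>
    refine ⟨fun h => ?_, fun h => Subtype.ext (unit_unique h hE (unit_mem_comp_self h) A.2)⟩
    rw [Sat] at h
    exact h ▸ hE
  | mbot =>
    rw [Sat, Ne, not_iff_comm]
    refine ⟨fun h => Subtype.ext (eq_inv_unit A.2 h), fun h => ?_⟩
    rw [h]
    exact mbot_notMem_inv_unit hE
  | mneg F ih =>
    simp only [Sat, ih]
    exact mneg_mem.symm
  | star F G ihF ihG =>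
    simp only [Sat, ihF, ihG]
    rw [star_mem]
    refine ⟨fun ⟨B, C, h⟩ => ⟨B.1, C.1, h⟩, fun ⟨B, C, hA, h⟩ => ?_⟩
    obtain ⟨hB, hC⟩ := mem_comp_unit_of_comp_mem hE A.2 hA
    exact ⟨⟨B, hB⟩, ⟨C, hC⟩, hA, h⟩
  | mor F G ihF ihG =>
    simp only [Sat, ihF, ihG]
    rw [mor_mem]
    refine ⟨fun h B C hA => ?_, fun h B C => h B.1 C.1⟩
    obtain ⟨hB, hC⟩ := mem_comp_unit_of_comp_mem hE (inv_mem_comp_unit hE A.2) hA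
    exact h ⟨B, hB⟩ ⟨C, hC⟩ hA
  | wand F G ihF ihG =>
    simp only [Sat, ihF, ihG]
    rw [wand_mem]
    refine ⟨fun h B C hC => ?_, fun h B C => h B.1 C.1⟩
    obtain ⟨hB, hC'⟩ := mem_comp_unit_of_mem_comp hE A.2 hC.1
    exact h ⟨B, hB⟩ ⟨C, hC'⟩ hC

end World

/-- Worlds live in `Type u` so that the countermodel lies in the universe over which validity
quantifies. -/
theorem Entails.of_valid {F G : Formula} (h : Formula.Valid.{u} (.imp F G)) : Entails F G := by
  by_contra hFG
  obtain ⟨A, hA, hG⟩ := exists_world_of_notMem.{u} (isFilter_principal F) hFG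
  obtain ⟨E, hE, hAE⟩ := A.exists_unit
  have hs := (World.sat_iff_mem hE _ ⟨A, hAE⟩).1 (h _ (World.model E hE) _ _)
  exact hG (World.imp_mem.1 hs (hA (Entails.refl F)))

end CBI

/-- Completeness of the display calculus: every valid consecution `X ⊢ Y` is provable. -/
theorem theorem3p10 (X Y : CBI.Structure)
    (h : CBI.Consecution.Valid.{u} ⟨X, Y⟩) : CBI.Provable ⟨X, Y⟩ :=
  CBI.Entails.provable (CBI.Entails.of_valid h)
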